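/- Let $p$ and $q$ be distinct odd primes. Let $m$ be the smallest positive integer such that $p$ divides $|\mathrm{Sp}(2m,q)|$, and let $n$ be the smallest positive integer such that $q$ divides $|\mathrm{Sp}(2n,p)|$. Let $A = Q \rtimes H$ be a semidirect product of an extra-special $q$-group $Q$ of order $q^{2m+1}$ and exponent $q$ with a cyclic group $H$ of order $p$ acting trivially on $Z(Q)$ and faithfully on $Q/Z(Q)$. Let $B = P \rtimes K$ be a semidirect product of an extra-special $p$-group $P$ of order $p^{2n+1}$ and exponent $p$ with a cyclic group $K$ of order $q$ acting trivially on $Z(P)$ and faithfully on $P/Z(P)$. Let $C$ be a cyclic group of order $pq$, identified via injective homomorphisms $C \to A$ and $C \to B$ with a Carter subgroup (that is, a self-normalizing nilpotent subgroup) of $A$ and with a Carter subgroup of $B$, and let $X = A *_C B$ be the resulting amalgam (free product with amalgamation). If $x \in X$ is an element no conjugate of which lies in (the image of) $A \cup B$, then the centralizer $C_X(x)$ is torsion-free (its only element of finite order is the identity), has non-trivial centre, and is free of rank $1$, that is, infinite cyclic. -/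

import Mathlib

universe u

/-- Extra-special `p`-groups: finite `p`-groups whose centre, derived subgroup and Frattini
subgroup coincide and have order `p`. -/
structure IsExtraspecial (p : ℕ) (G : Type*) [Group G] : Prop where
  finite : Finite G
  isPGroup : IsPGroup p G
  card_center : Nat.card (Subgroup.center G) = p
  commutator_eq : commutator G = Subgroup.center G
  frattini_eq : frattini G = Subgroup.center G

/-- Carter subgroups: self-normalizing nilpotent subgroups. -/
structure IsCarterSubgroup {G : Type*} [Group G] (K : Subgroup G) : Prop where
  nilpotent : Group.IsNilpotent K
  normalizer_eq : Subgroup.normalizer (K : Set G) = K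

/-- `m` is the smallest positive integer such that `p` divides the order of `Sp(2m, q)`. -/
def IsMinimalSymplecticRank (p q m : ℕ) : Prop :=
  IsLeast {k : ℕ | 0 < k ∧ p ∣ Nat.card (Matrix.symplecticGroup (Fin k) (ZMod q))} m

/-- The requirements on an action `φ` of a group `H` on a group `Q` whose semidirect product
`Q ⋊[φ] H` is one factor of the amalgam: `Q` is extra-special of order `q ^ (2 * m + 1)` and
exponent `q`, where `m` is minimal with `p ∣ |Sp(2m, q)|`, and `H` is cyclic of order `p`, acting
trivially on `Z(Q)` and faithfully on `Q / Z(Q)`. -/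
structure IsFactorAction (p q : ℕ) {Q H : Type*} [Group Q] [Group H] (φ : H →* MulAut Q) :
    Prop where
  extraspecial : IsExtraspecial q Q
  card_eq : ∃ m : ℕ, IsMinimalSymplecticRank p q m ∧ Nat.card Q = q ^ (2 * m + 1)
  exponent_eq : Monoid.exponent Q = q
  cyclic : IsCyclic H
  card_acting : Nat.card H = p
  trivial_on_center : ∀ h : H, ∀ z ∈ Subgroup.center Q, φ h z = z
  faithful_on_quotient : ∀ h : H,
    (∀ x : Q, (QuotientGroup.mk (φ h x) : Q ⧸ Subgroup.center Q) = QuotientGroup.mk x) → h = 1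

/-- The family consisting of the two groups `A` and `B`. -/
def AmalgamFactor (A B : Type u) : Bool → Type u
  | false => A
  | true => B

instance AmalgamFactor.instGroup (A B : Type u) [Group A] [Group B] :
    ∀ i, Group (AmalgamFactor A B i)
  | false => inferInstanceAs (Group A)
  | true => inferInstanceAs (Group B)

/-- The family consisting of the two maps `f : C →* A` and `g : C →* B`. -/
def amalgamMap {A B : Type u} {C : Type*} [Group A] [Group B] [Group C]
    (f : C →* A) (g : C →* B) : ∀ i, C →* AmalgamFactor A B i
  | false => f
  | true => g

/-- The amalgam `A *_C B`, the pushout in groups of `f : C →* A` and `g : C →* B`. -/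
abbrev Amalgam {A B : Type u} {C : Type*} [Group A] [Group B] [Group C]
    (f : C →* A) (g : C →* B) : Type _ :=
  Monoid.PushoutI (amalgamMap f g)

/-- The canonical map `A → A *_C B`. -/
def Amalgam.inl {A B : Type u} {C : Type*} [Group A] [Group B] [Group C]
    (f : C →* A) (g : C →* B) : A →* Amalgam f g :=
  Monoid.PushoutI.of (φ := amalgamMap f g) false

/-- The canonical map `B → A *_C B`. -/
def Amalgam.inr {A B : Type u} {C : Type*} [Group A] [Group B] [Group C]
    (f : C →* A) (g : C →* B) : B →* Amalgam f g :=
  Monoid.PushoutI.of (φ := amalgamMap f g) true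

/-!
The proof is Bass–Serre theory for the amalgam `X = A *_C B`, carried out with normal forms. The
edges of the Bass–Serre tree are the right cosets of `C` in `X`, and the distance of the cosets of
`g` and `h` is the syllable length of `g * h⁻¹`.

*The factors.* Since `H` centralizes `Z(Q)`, the group `Z(Q)` of order `q` is central in
`A = Q ⋊ H`, hence normalizes `C` and so lies in `C`. If `a ∈ A` is not in `C`, then the
intersection of `C` with its conjugate by `a` contains `Z(Q)` and is proper in `C`, because `C` is
self-normalizing. As `|C| = p * q`, the intersection has order `q`
(`IsFactorAction.pow_eq_one_of_conj_mem_range`). In the same way, `C` meets its proper conjugates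
in `B` in groups of order `p`. An element of `X` fixing three consecutive edges of the tree
fixes two adjacent edges at a vertex of either type, so its order divides both `q` and `p`, and it
is trivial.

*The axis.* If no conjugate of `x` lies in `A ∪ B`, then a conjugate of minimal length is cyclically
reduced, and the suffixes of its powers trace a line in the tree on which it acts as a
translation (`Monoid.PushoutI.exists_isAxis`). An element commuting with `x` preserves this line
(`Monoid.PushoutI.IsAxis.exists_mem_range`) and, being compatible with the translation, acts on it
as a translation itself, not as a reflection (`Monoid.PushoutI.IsAxis.exists_translation`).

So the centralizer of `x` maps to `ℤ`, and by the first part the kernel of this action is trivial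
(`Monoid.PushoutI.exists_centralizer_hom_injective`). As the centralizer contains `x ≠ 1`, it is
isomorphic to a nontrivial subgroup of `ℤ`.
-/

namespace Monoid.PushoutI

open NormalWord

section Syllables

variable {ι : Type*} {G : ι → Type*} {H : Type*} [∀ i, Group (G i)] [Group H]
  {φ : ∀ i, H →* G i} (d : Transversal φ)

/-! ### Syllable length in an amalgam -/

open scoped Classical in
/-- The normal form of an element of the amalgam, with respect to the transversal `d`. -/
noncomputable def normalForm (x : PushoutI φ) : NormalWord d := x • empty

/-- The syllable length: the number of letters in the normal form. It vanishes exactly on the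
amalgamated subgroup. -/
noncomputable def len (x : PushoutI φ) : ℕ := (normalForm d x).toList.length

/-- The index of the factor containing the first syllable, or `none` on the amalgamated
subgroup. -/
noncomputable def fst (x : PushoutI φ) : Option ι := (normalForm d x).fstIdx

theorem prod_normalForm (x : PushoutI φ) : (normalForm d x).prod = x := by
  classical
  have h : normalForm d x = x • (empty : NormalWord d) := by
    unfold normalForm; congr!
  rw [h, prod_smul, prod_empty, mul_one]

variable {d} in
theorem normalForm_eq {x : PushoutI φ} {w : NormalWord d} (h : w.prod = x) :
    normalForm d x = w :=
  prod_injective ((prod_normalForm d x).trans h.symm)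

theorem normalForm_one : normalForm d 1 = empty := normalForm_eq prod_empty

@[simp]
theorem len_one : len d (1 : PushoutI φ) = 0 := by
  simp [len, normalForm_one]

@[simp]
theorem fst_one : fst d (1 : PushoutI φ) = none := by
  simp [fst, normalForm_one, CoprodI.Word.fstIdx]

theorem normalForm_base_mul (c : H) (x : PushoutI φ) :
    normalForm d (base φ c * x) = c • normalForm d x :=
  normalForm_eq (by rw [prod_base_smul, prod_normalForm])

@[simp]
theorem len_base_mul (c : H) (x : PushoutI φ) : len d (base φ c * x) = len d x := by
  rw [len, normalForm_base_mul]; rfl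

@[simp]
theorem len_base (c : H) : len d (base φ c) = 0 := by
  rw [← mul_one (base φ c), len_base_mul, len_one]

theorem len_eq_zero_iff {x : PushoutI φ} : len d x = 0 ↔ x ∈ (base φ).range := by
  refine ⟨fun h => ⟨(normalForm d x).head, ?_⟩, ?_⟩
  · have h' := prod_normalForm d x
    rw [NormalWord.prod, CoprodI.Word.prod, List.eq_nil_of_length_eq_zero h] at h'
    simpa using h'
  · rintro ⟨c, rfl⟩
    exact len_base d c

theorem fst_eq_none_iff {x : PushoutI φ} : fst d x = none ↔ len d x = 0 := by
  simp [fst, len, CoprodI.Word.fstIdx]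

variable {d}

theorem len_of_mul {i : ι} {a : G i} (ha : a ∉ (φ i).range) {x : PushoutI φ}
    (hx : fst d x ≠ some i) : len d (of i a * x) = len d x + 1 := by
  rw [fst] at hx
  rw [len, normalForm_eq (w := cons a (normalForm d x) hx ha)
    (by rw [prod_cons, prod_normalForm])]
  simp [cons, CoprodI.Word.cons, len]

theorem fst_of_mul {i : ι} {a : G i} (ha : a ∉ (φ i).range) {x : PushoutI φ}
    (hx : fst d x ≠ some i) : fst d (of i a * x) = some i := by
  rw [fst] at hx
  rw [fst, normalForm_eq (w := cons a (normalForm d x) hx ha)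
    (by rw [prod_cons, prod_normalForm])]
  simp [cons]

theorem exists_eq_of_mul_of_fst {x : PushoutI φ} {i : ι} (hx : fst d x = some i) :
    ∃ a ∉ (φ i).range, ∃ v, x = of i a * v ∧ fst d v ≠ some i := by
  classical
  have key : ∀ w : NormalWord d, w.fstIdx = some i →
      ∃ a ∉ (φ i).range, ∃ v, w.prod = of i a * v ∧ fst d v ≠ some i := by
    intro w
    induction w using consRecOn with
    | empty => intro h; simp [CoprodI.Word.fstIdx] at h
    | cons j a w hw _ ha _ _ =>
      intro h
      obtain rfl : j = i := by simpa [cons] using h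
      exact ⟨a, ha, w.prod, prod_cons a w hw ha, by rwa [fst, normalForm_eq rfl]⟩
    | base c w _ ih =>
      intro h
      obtain ⟨a, ha, v, hv, hv'⟩ := ih h
      refine ⟨φ i c * a, ?_, v, ?_, hv'⟩
      · rwa [Subgroup.mul_mem_cancel_left _ (MonoidHom.mem_range.2 ⟨c, rfl⟩)]
      · rw [prod_smul, hv, map_mul, of_apply_eq_base, mul_assoc]
  rw [← prod_normalForm d x]
  exact key _ hx

/-- An element outside the amalgamated subgroup splits off its first syllable. -/
theorem exists_eq_of_mul {x : PushoutI φ} (hx : len d x ≠ 0) :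
    ∃ i, ∃ a ∉ (φ i).range, ∃ v, x = of i a * v ∧ fst d v ≠ some i ∧
      len d x = len d v + 1 ∧ fst d x = some i := by
  rw [ne_eq, ← fst_eq_none_iff, ← ne_eq, Option.ne_none_iff_exists'] at hx
  obtain ⟨i, hi⟩ := hx
  obtain ⟨a, ha, v, rfl, hv⟩ := exists_eq_of_mul_of_fst hi
  exact ⟨i, a, ha, v, rfl, hv, len_of_mul ha hv, hi⟩

theorem of_mem_range_eq_base {i : ι} {a : G i} (ha : a ∈ (φ i).range) :
    ∃ c, of i a = base φ c := by
  obtain ⟨c, rfl⟩ := ha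
  exact ⟨c, of_apply_eq_base φ i c⟩

theorem len_of_mul_of_fst_le {i : ι} (a : G i) {x : PushoutI φ} (hx : fst d x = some i) :
    len d (of i a * x) ≤ len d x := by
  obtain ⟨b, hb, v, rfl, hv⟩ := exists_eq_of_mul_of_fst hx
  rw [len_of_mul hb hv, ← mul_assoc, ← map_mul]
  by_cases h : a * b ∈ (φ i).range
  · obtain ⟨c, hc⟩ := of_mem_range_eq_base h
    simp [hc]
  · rw [len_of_mul h hv]

theorem len_of_mul_le {i : ι} (a : G i) (x : PushoutI φ) :
    len d (of i a * x) ≤ len d x + 1 := by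
  by_cases hx : fst d x = some i
  · exact (len_of_mul_of_fst_le a hx).trans (Nat.le_succ _)
  · by_cases h : a ∈ (φ i).range
    · obtain ⟨c, hc⟩ := of_mem_range_eq_base h
      simp [hc]
    · rw [len_of_mul h hx]

theorem len_of_le {i : ι} (a : G i) : len d (of (φ := φ) i a) ≤ 1 := by
  simpa using len_of_mul_le (d := d) a 1

theorem len_mul_le (x y : PushoutI φ) : len d (x * y) ≤ len d x + len d y := by
  induction h : len d x generalizing x with
  | zero =>
    obtain ⟨c, rfl⟩ := (len_eq_zero_iff d).1 h
    simp
  | succ n ih =>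
    obtain ⟨i, a, _, v, rfl, _, hl, _⟩ := exists_eq_of_mul (d := d) (x := x) (by omega)
    have := ih v (by omega)
    have := len_of_mul_le (d := d) a (v * y)
    rw [mul_assoc]
    omega

theorem len_inv_le (x : PushoutI φ) : len d x⁻¹ ≤ len d x := by
  induction h : len d x generalizing x with
  | zero =>
    obtain ⟨c, rfl⟩ := (len_eq_zero_iff d).1 h
    simp [← map_inv]
  | succ n ih =>
    obtain ⟨i, a, _, v, rfl, _, hl, _⟩ := exists_eq_of_mul (d := d) (x := x) (by omega)
    have := ih v (by omega)
    have := len_of_le (d := d) (φ := φ) a⁻¹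
    rw [mul_inv_rev, ← map_inv]
    have := len_mul_le (d := d) v⁻¹ (of (φ := φ) i a⁻¹)
    omega

theorem len_inv (x : PushoutI φ) : len d x⁻¹ = len d x :=
  (len_inv_le x).antisymm (by simpa using len_inv_le (d := d) x⁻¹)

theorem len_mul_base (x : PushoutI φ) (c : H) : len d (x * base φ c) = len d x := by
  rw [← len_inv, mul_inv_rev, ← map_inv, len_base_mul, len_inv]

/-- Two reduced expressions of one element with tails of the same length have tails that agree up
to the amalgamated subgroup. -/
theorem exists_eq_base_mul_of_of_mul_eq {i : ι} {a b : G i} {u v : PushoutI φ}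
    (hv : fst d v ≠ some i) (hl : len d u = len d v) (h : of i a * u = of i b * v) :
    ∃ c, u = base φ c * v := by
  have hu : u = of i (a⁻¹ * b) * v := by
    rw [map_mul, map_inv, mul_assoc, ← h, inv_mul_cancel_left]
  by_cases hab : a⁻¹ * b ∈ (φ i).range
  · obtain ⟨c, hc⟩ := of_mem_range_eq_base hab
    exact ⟨c, hc ▸ hu⟩
  · have := len_of_mul hab hv
    rw [← hu] at this
    omega

end Syllables

section Axis

variable {ι : Type*} {G : ι → Type*} {H : Type*} [∀ i, Group (G i)] [Group H]
  {φ : ∀ i, H →* G i} {d : Transversal φ}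

/-! ### Axes of hyperbolic elements -/

/-- An axis of `x`: a bi-infinite reduced sequence of right cosets `C * h n` of the amalgamated
subgroup, consecutive ones differing by a letter of the factor `t n`, on which right
multiplication by `x⁻¹` is the shift by the positive number `L`. The cosets are the edges of the
Bass–Serre tree that the translation axis of `x` traverses, the indices `t n` are the types of its
vertices. -/
structure IsAxis (x : PushoutI φ) (L : ℕ) (h : ℤ → PushoutI φ) (t : ℤ → ι) : Prop where
  pos : 0 < L
  step : ∀ n, ∃ a ∉ (φ (t n)).range, h n = of (t n) a * h (n + 1)
  alternating : ∀ n, t n ≠ t (n + 1)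
  shift : ∀ n, h (n + L) = h n * x⁻¹
  shift_type : ∀ n, t (n + L) = t n

namespace IsAxis

variable {x : PushoutI φ} {L : ℕ} {h : ℤ → PushoutI φ} {t : ℤ → ι}

/-- The distance of the cosets of `h n` and `w⁻¹` is `len d (h n * w)`. Once a path from the coset of
`w⁻¹` enters the axis without backtracking, it grows by one syllable with each further step. -/
theorem len_mul (hA : IsAxis x L h t) (w : PushoutI φ) (k : ℕ) (n : ℤ)
    (hw : fst d (h (n + k) * w) ≠ some (t (n + k - 1))) :
    len d (h n * w) = len d (h (n + k) * w) + k ∧ fst d (h n * w) ≠ some (t (n - 1)) := by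
  induction k generalizing n with
  | zero => simpa using hw
  | succ k ih =>
    have e : n + (k + 1 : ℕ) = n + 1 + k := by push_cast; ring
    rw [e] at hw ⊢
    obtain ⟨h1, h2⟩ := ih (n + 1) hw
    rw [add_sub_cancel_right] at h2
    obtain ⟨a, ha, hs⟩ := hA.step n
    rw [hs, mul_assoc, len_of_mul ha h2, fst_of_mul ha h2, h1]
    refine ⟨by omega, fun h => hA.alternating (n - 1) ?_⟩
    rw [sub_add_cancel, Option.some.inj h]

theorem len_mul_inv (hA : IsAxis x L h t) (n m : ℤ) :
    len d (h n * (h m)⁻¹) = (n - m).natAbs := by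
  have key : ∀ (k : ℕ) (n : ℤ), len d (h n * (h (n + k))⁻¹) = k := fun k n => by
    simpa using (hA.len_mul (d := d) (h (n + k))⁻¹ k n (by simp)).1
  rcases le_total n m with hnm | hnm
  · obtain ⟨k, rfl⟩ := Int.le.dest hnm
    rw [key]; omega
  · obtain ⟨k, rfl⟩ := Int.le.dest hnm
    rw [← len_inv, mul_inv_rev, inv_inv, key]; omega

theorem shift_neg (hA : IsAxis x L h t) (n : ℤ) : h (n - L) = h n * x := by
  have := hA.shift (n - L)
  rw [sub_add_cancel] at this
  rw [this, inv_mul_cancel_right]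

theorem shift_type_neg (hA : IsAxis x L h t) (n : ℤ) : t (n - L) = t n := by
  rw [← hA.shift_type, sub_add_cancel]

/-- For each `w`, among the cosets of the axis closest to `w⁻¹` there is one from which the path
to `w⁻¹` does not leave through the preceding vertex of the axis. -/
theorem exists_closest (hA : IsAxis x L h t) (w : PushoutI φ) :
    ∃ m, (∀ n, len d (h m * w) ≤ len d (h n * w)) ∧ fst d (h m * w) ≠ some (t (m - 1)) := by
  obtain ⟨m, hm⟩ : ∃ m, ∀ n, len d (h m * w) ≤ len d (h n * w) := by
    obtain ⟨m, -, hm⟩ := WellFounded.has_min (measure fun n : ℤ => len d (h n * w)).wf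
      Set.univ ⟨0, trivial⟩
    exact ⟨m, fun n => not_lt.1 (hm n trivial)⟩
  by_cases hf : fst d (h m * w) = some (t (m - 1))
  · -- In this case the preceding coset is equally close and has the required property.
    obtain ⟨a, -, hs⟩ := hA.step (m - 1)
    rw [sub_add_cancel] at hs
    have hle : len d (h (m - 1) * w) ≤ len d (h m * w) := by
      rw [hs, mul_assoc]
      exact len_of_mul_of_fst_le a hf
    refine ⟨m - 1, fun n => hle.trans (hm n), fun hf' => ?_⟩
    obtain ⟨b, hb, v, hv, hv'⟩ := exists_eq_of_mul_of_fst hf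
    have hvl := len_of_mul hb hv'
    rw [← hv] at hvl
    have hab : of (t (m - 1)) (a * b) * v = h (m - 1) * w := by
      rw [hs, mul_assoc, hv, map_mul, mul_assoc]
    by_cases hr : a * b ∈ (φ (t (m - 1))).range
    · obtain ⟨c, hc⟩ := of_mem_range_eq_base hr
      have := hm (m - 1)
      rw [← hab, hc, len_base_mul] at this
      omega
    · have := fst_of_mul hr hv'
      rw [hab, hf', Option.some.injEq] at this
      refine hA.alternating (m - 1 - 1) ?_
      rw [sub_add_cancel, this]
  · exact ⟨m, hm, hf⟩

/-- An element commuting with `x` maps the axis of `x` to itself. Suppose that the coset of `w⁻¹`,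
where `w⁻¹ = h j * y⁻¹`, lies at distance `D > 0` from the axis, with `h m` closest to it. Its
translate by `x⁻¹` is at distance `L` from it, as `y` commutes with `x`, and at distance `D + L`
from `h m`, by a path that starts along the axis. So this path leads through the coset of `w⁻¹`,
and the path from `h m` to that coset starts along the axis as well, which makes `h (m + 1)`
closer. -/
theorem exists_mem_range (hA : IsAxis x L h t) {y : PushoutI φ} (hy : Commute y x) (j : ℤ)
    (d : Transversal φ) : ∃ m, h m * y * (h j)⁻¹ ∈ (base φ).range := by
  set w := y * (h j)⁻¹ with hw
  obtain ⟨m, hm, hf⟩ := hA.exists_closest (d := d) w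
  refine ⟨m, ?_⟩
  rw [mul_assoc, ← hw, ← len_eq_zero_iff d]
  by_contra hD
  have hL := hA.pos
  set s := h j * x * (h j)⁻¹ with hs
  have hws : w * s = x * w := by
    rw [hw, hs, mul_assoc (h j), mul_assoc y, inv_mul_cancel_left, ← mul_assoc, hy.eq, mul_assoc]
  have hsl : len d s = L := by
    rw [hs, ← hA.shift_neg, hA.len_mul_inv]; omega
  -- Continuing from `h m` to `h (m - L)`, the path to `w⁻¹` grows by `L` syllables.
  have h1 := (hA.len_mul (d := d) w L (m - L) (by simpa using hf)).1
  rw [sub_add_cancel, hA.shift_neg, mul_assoc, ← hws] at h1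
  have h2 := hA.len_mul (d := d) w (L - 1) (m + 1 - L) (by
    rwa [show m + 1 - L + (L - 1 : ℕ) = m by omega])
  rw [show m + 1 - L + (L - 1 : ℕ) = m by omega, hA.shift_neg,
    show m + 1 - L - 1 = m - L by ring, hA.shift_type_neg, mul_assoc, ← hws] at h2
  obtain ⟨i, b, hb, r, hr, -, hrl, -⟩ := exists_eq_of_mul hD
  obtain ⟨a, ha, hstep⟩ := hA.step m
  have e1 : h m * (w * s) = of i b * (r * s) := by rw [← mul_assoc, hr, mul_assoc]
  have e2 : h m * (w * s) = of (t m) a * (h (m + 1) * (w * s)) := by rw [hstep, mul_assoc]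
  have hle := len_mul_le (d := d) r s
  have hle' := len_of_mul_le (d := d) b (r * s)
  rw [← e1] at hle'
  have hfrs : fst d (r * s) ≠ some i := fun hfi => by
    have := len_of_mul_of_fst_le b hfi
    rw [← e1] at this
    omega
  -- The expressions `e1` and `e2` of one element are both reduced, so they start in the same factor,
  -- and their tails agree up to the amalgamated subgroup.
  obtain rfl : i = t m := by
    have := fst_of_mul hb hfrs
    rw [← e1, e2, fst_of_mul ha h2.2] at this
    exact (Option.some.inj this).symm
  obtain ⟨c, hc⟩ := exists_eq_base_mul_of_of_mul_eq (d := d) h2.2 (by omega) (e1.symm.trans e2)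
  rw [← mul_assoc (h (m + 1)), ← mul_assoc (base φ c), mul_left_inj] at hc
  have := hm (m + 1)
  rw [hc, len_base_mul] at hrl
  omega

theorem eq_of_mem_range (hA : IsAxis x L h t) (d : Transversal φ) {y : PushoutI φ} {m n j : ℤ}
    (hm : h m * y * (h j)⁻¹ ∈ (base φ).range) (hn : h n * y * (h j)⁻¹ ∈ (base φ).range) :
    m = n := by
  have := (base φ).range.mul_mem hm ((base φ).range.inv_mem hn)
  rw [show h m * y * (h j)⁻¹ * (h n * y * (h j)⁻¹)⁻¹ = h m * (h n)⁻¹ by group,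
    ← len_eq_zero_iff d, hA.len_mul_inv] at this
  omega

/-- An element commuting with `x` acts on the axis of `x` as a translation. -/
theorem exists_translation (hA : IsAxis x L h t) {y : PushoutI φ} (hy : Commute y x)
    (d : Transversal φ) : ∃ τ : ℤ, ∀ j, h (j + τ) * y * (h j)⁻¹ ∈ (base φ).range := by
  choose σ hσ using fun j => hA.exists_mem_range hy j d
  have hdist : ∀ j k, (σ j - σ k).natAbs = (j - k).natAbs := fun j k => by
    obtain ⟨c, hc⟩ := hσ j
    obtain ⟨c', hc'⟩ := hσ k
    have : h (σ j) * (h (σ k))⁻¹ = base φ c * (h j * (h k)⁻¹ * base φ c'⁻¹) := by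
      rw [map_inv, hc, hc']; group
    rw [← hA.len_mul_inv (d := d), ← hA.len_mul_inv (d := d), this, len_base_mul, len_mul_base]
  have hshift : σ L = σ 0 + L := by
    refine hA.eq_of_mem_range d (hσ L) ?_
    have e : h (L : ℤ) = h 0 * x⁻¹ := by simpa using hA.shift 0
    rw [hA.shift, e]
    convert hσ 0 using 1
    rw [mul_inv_rev, inv_inv, mul_assoc _ x⁻¹ y, ← hy.inv_right.eq]
    group
  have hL := hA.pos
  refine ⟨σ 0, fun j => ?_⟩
  -- An isometry of `ℤ` commuting with the shift by `L > 0` is a translation, not a reflection.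
  have : j + σ 0 = σ j := by
    have h1 := hdist j 0
    have h2 := hdist j L
    omega
  rw [this]
  exact hσ j

/-- The centralizer of `x` acts on the axis of `x` by translations, and the elements acting trivially
lie in the conjugates of the amalgamated subgroup by all `h j`. -/
theorem exists_hom (hA : IsAxis x L h t) (d : Transversal φ) :
    ∃ T : Subgroup.centralizer {x} →* Multiplicative ℤ,
      ∀ y, T y = 1 → ∀ j, h j * y * (h j)⁻¹ ∈ (base φ).range := by
  choose τ hτ using fun y : Subgroup.centralizer {x} =>
    hA.exists_translation (Subgroup.mem_centralizer_singleton_iff.1 y.2) d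
  refine ⟨MonoidHom.mk' (fun y => Multiplicative.ofAdd (τ y)) fun y z => ?_, fun y hy j => ?_⟩
  · rw [← ofAdd_add]
    congr 1
    have := (base φ).range.mul_mem (hτ y (0 + τ z)) (hτ z 0)
    have := hA.eq_of_mem_range d (hτ (y * z) 0) (n := 0 + τ z + τ y) (by
      convert this using 1
      push_cast
      group)
    omega
  · have : τ y = 0 := by simpa using hy
    simpa [this] using hτ y j

end IsAxis

/-- An element outside the amalgamated subgroup splits off its first syllable, in such a way that
the remainder of a one-syllable element is `1`. -/
theorem exists_eq_of_mul_of_eq_one {x : PushoutI φ} (hx : len d x ≠ 0) :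
    ∃ v, (∃ i, ∃ a ∉ (φ i).range, x = of i a * v ∧ fst d x = some i) ∧ fst d v ≠ fst d x ∧
      len d x = len d v + 1 ∧ (len d v = 0 → v = 1) := by
  obtain ⟨i, a, ha, v, rfl, hv, hl, hf⟩ := exists_eq_of_mul hx
  by_cases h : len d v = 0
  · obtain ⟨c, rfl⟩ := (len_eq_zero_iff d).1 h
    refine ⟨1, ⟨i, a * φ i c, ?_, ?_, hf⟩, ?_, ?_, fun _ => rfl⟩
    · rwa [Subgroup.mul_mem_cancel_right _ (MonoidHom.mem_range.2 ⟨c, rfl⟩)]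
    · rw [map_mul, of_apply_eq_base, mul_one]
    · simp [hf]
    · rw [hl, h, len_one]
  · exact ⟨v, ⟨i, a, ha, rfl, hf⟩, hf ▸ hv, hl, fun h' => absurd h' h⟩

/-- If `x` is not conjugate into a factor, then some conjugate of `x` has an axis, formed by the
suffixes of its normal form: a conjugate of minimal length is cyclically reduced. -/
theorem exists_isAxis {x : PushoutI φ} (d : Transversal φ) [Nonempty ι]
    (hx : ∀ y i, y * x * y⁻¹ ∉ (of (φ := φ) i).range) :
    ∃ y L h t, IsAxis (y * x * y⁻¹) L h t := by
  obtain ⟨y, hy⟩ : ∃ y, ∀ z, len d (y * x * y⁻¹) ≤ len d (z * x * z⁻¹) := by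
    obtain ⟨y, -, hy⟩ := WellFounded.has_min (measure fun y => len d (y * x * y⁻¹)).wf
      Set.univ ⟨1, trivial⟩
    exact ⟨y, fun z => not_lt.1 (hy z trivial)⟩
  set u := y * x * y⁻¹ with hu
  let i₀ : ι := Classical.arbitrary ι
  have hu0 : len d u ≠ 0 := fun h0 => by
    obtain ⟨c, hc⟩ := (len_eq_zero_iff d).1 h0
    exact hx y i₀ ⟨φ i₀ c, by rw [of_apply_eq_base, hc]⟩
  choose! p hp using fun v : PushoutI φ => exists_eq_of_mul_of_eq_one (d := d) (x := v)
  obtain ⟨L, hL⟩ : ∃ L, len d u = L := ⟨_, rfl⟩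
  -- The suffixes of `u` and the factors of their first letters.
  let v : ℕ → PushoutI φ := fun k => p^[k] u
  let s : ℕ → ι := fun k => (fst d (v k)).getD i₀
  have hv0 : v 0 = u := rfl
  have hv : ∀ k, v (k + 1) = p (v k) := fun k => Function.iterate_succ_apply' p k u
  have hlen : ∀ k ≤ L, len d (v k) + k = L := fun k => by
    induction k with
    | zero => simp [hv0, hL]
    | succ k ih =>
      intro hk
      have := ih (by omega)
      have := (hp (v k) (by omega)).2.2.1
      rw [hv]
      omega
  have hstep : ∀ k < L, fst d (v k) = some (s k) ∧
      ∃ a ∉ (φ (s k)).range, v k = of (s k) a * v (k + 1) := fun k hk => by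
    have := hlen k hk.le
    obtain ⟨i, a, ha, he, hf⟩ := (hp (v k) (by omega)).1
    obtain rfl : s k = i := by simp [s, hf]
    exact ⟨hf, a, ha, by rwa [hv]⟩
  have halt : ∀ k, k + 1 < L → s k ≠ s (k + 1) := fun k hk he => by
    have := hlen k (by omega)
    refine (hp (v k) (by omega)).2.1 ?_
    rw [← hv, (hstep k (by omega)).1, (hstep (k + 1) hk).1, he]
  have hvL : v L = 1 := by
    obtain ⟨k, rfl⟩ : ∃ k, L = k + 1 := ⟨L - 1, by omega⟩
    have h1 := hlen k (by omega)
    have h2 := hlen (k + 1) le_rfl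
    rw [hv] at h2 ⊢
    exact (hp (v k) (by omega)).2.2.2 (by omega)
  have hL1 : 1 < L := by
    by_contra hL1
    obtain rfl : L = 1 := by omega
    obtain ⟨-, a, -, ha⟩ := hstep 0 (by omega)
    exact hx y (s 0) ⟨a, by rw [← hu, ← hv0, ha, hvL, mul_one]⟩
  -- If first and last letter were in the same factor, moving the first letter to the end would
  -- yield a shorter conjugate.
  have hwrap : s (L - 1) ≠ s 0 := fun he => by
    obtain ⟨-, a, -, ha⟩ := hstep 0 (by omega)
    have key : ∀ j, j + 1 < L → len d (v (L - 1 - j) * of (s 0) a) ≤ j + 1 := fun j => by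
      induction j with
      | zero =>
        intro _
        obtain ⟨-, b, -, hb⟩ := hstep (L - 1) (by omega)
        rw [Nat.sub_add_cancel (by omega), hvL, mul_one] at hb
        rw [Nat.sub_zero, hb]
        revert b
        rw [he]
        intro b _
        rw [← map_mul]
        exact len_of_le _
      | succ j ih =>
        intro hj
        obtain ⟨-, b, -, hb⟩ := hstep (L - 1 - (j + 1)) (by omega)
        rw [hb, show L - 1 - (j + 1) + 1 = L - 1 - j by omega, mul_assoc]
        have := ih (by omega)
        have := len_of_mul_le (d := d) b (v (L - 1 - j) * of (s 0) a)
        omega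
    have h1 := key (L - 2) (by omega)
    rw [show L - 1 - (L - 2) = 0 + 1 by omega] at h1
    have h2 := hy ((of (s 0) a)⁻¹ * y)
    have e : (of (s 0) a)⁻¹ * y * x * ((of (s 0) a)⁻¹ * y)⁻¹ = v (0 + 1) * of (s 0) a := by
      rw [← inv_mul_eq_iff_eq_mul.2 ha, hv0, hu]
      group
    rw [e] at h2
    omega
  have hL0 : (L : ℤ) ≠ 0 := by omega
  let h : ℤ → PushoutI φ := fun n => v (n % L).toNat * u ^ (-(n / L))
  let t : ℤ → ι := fun n => s (n % L).toNat
  have hmod : ∀ (q : ℤ) (k : ℕ), k < L → ((k + L * q) % L).toNat = k := fun q k hk => by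
    rw [Int.add_mul_emod_self_left, Int.emod_eq_of_lt (by omega) (by omega), Int.toNat_natCast]
  have hdiv : ∀ (q : ℤ) (k : ℕ), k < L → (k + L * q) / L = q := fun q k hk => by
    rw [Int.add_mul_ediv_left _ _ hL0, Int.ediv_eq_zero_of_lt (by omega) (by omega), zero_add]
  have ht : ∀ (q : ℤ) (k : ℕ), k < L → t (k + L * q) = s k := fun q k hk => by
    simp only [t, hmod q k hk]
  have hh : ∀ (q : ℤ) (k : ℕ), k ≤ L → h (k + L * q) = v k * u ^ (-q) := fun q k hk => by
    rcases hk.lt_or_eq with hk | rfl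
    · simp only [h, hmod q k hk, hdiv q k hk]
    · have e : (k : ℤ) + k * q = (0 : ℕ) + k * (q + 1) := by push_cast; ring
      simp only [h]
      rw [e, hmod _ 0 (by omega), hdiv _ 0 (by omega), hvL, hv0, ← zpow_one_add]
      simp
  have hn : ∀ n : ℤ, ∃ (q : ℤ) (k : ℕ), k < L ∧ n = k + L * q := fun n => by
    refine ⟨n / L, (n % L).toNat, ?_, ?_⟩
    · have := Int.emod_lt_of_pos n (show (0 : ℤ) < L by omega)
      omega
    · rw [Int.toNat_of_nonneg (Int.emod_nonneg _ hL0), Int.emod_add_mul_ediv]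
  refine ⟨y, L, h, t, by omega, fun n => ?_, fun n => ?_, fun n => ?_, fun n => ?_⟩
  all_goals obtain ⟨q, k, hk, rfl⟩ := hn n
  · obtain ⟨-, a, ha, he⟩ := hstep k hk
    rw [ht q k hk, hh q k hk.le,
      show (k : ℤ) + L * q + 1 = (k + 1 : ℕ) + L * q by push_cast; ring, hh q _ hk]
    exact ⟨a, ha, by rw [← mul_assoc, ← he]⟩
  · rw [ht q k hk]
    rcases Nat.lt_or_ge (k + 1) L with hk' | hk'
    · rw [show (k : ℤ) + L * q + 1 = (k + 1 : ℕ) + L * q by push_cast; ring, ht q _ hk']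
      exact halt k hk'
    · obtain rfl : k = L - 1 := by omega
      rw [show ((L - 1 : ℕ) : ℤ) + L * q + 1 = (0 : ℕ) + L * (q + 1) by
        push_cast [Nat.cast_sub hL1.le]; ring, ht _ 0 (by omega)]
      exact hwrap
  · rw [show (k : ℤ) + L * q + L = k + L * (q + 1) by ring, hh _ k hk.le, hh _ k hk.le, neg_add,
      zpow_add, zpow_neg_one, mul_assoc]
  · rw [show (k : ℤ) + L * q + L = k + L * (q + 1) by ring, ht _ k hk, ht _ k hk]

/-- An element in the kernel of the translation action fixes the two edges of the axis at the vertex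
of type `t j`, so it is conjugate into the intersection of the amalgamated subgroup with a proper
conjugate in `G (t j)`. -/
theorem IsAxis.pow_eq_one {x : PushoutI φ} {L : ℕ} {h : ℤ → PushoutI φ} {t : ℤ → ι}
    (hA : IsAxis x L h t) (hφ : ∀ i, Function.Injective (φ i)) {e : ι → ℕ}
    (hmal : ∀ i, ∀ a ∉ (φ i).range, ∀ c, a⁻¹ * φ i c * a ∈ (φ i).range → c ^ e i = 1)
    {z : PushoutI φ} (hz : ∀ j, h j * z * (h j)⁻¹ ∈ (base φ).range) (j : ℤ) :
    z ^ e (t j) = 1 := by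
  obtain ⟨a, ha, hs⟩ := hA.step j
  obtain ⟨c, hc⟩ := hz j
  obtain ⟨c', hc'⟩ := hz (j + 1)
  have hmem : a⁻¹ * φ (t j) c * a = φ (t j) c' := by
    refine of_injective hφ (t j) ?_
    rw [map_mul, map_mul, map_inv, of_apply_eq_base, of_apply_eq_base, hc, hc', hs]
    group
  have := congrArg (base φ) (hmal _ a ha c ⟨c', hmem.symm⟩)
  rwa [map_pow, hc, conj_pow, map_one, conj_eq_one_iff] at this

/-- Suppose the intersection of the amalgamated subgroup with a proper conjugate in the factor
`G i` has exponent dividing `e i`, where the `e i` are pairwise coprime. Then an element fixing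
three consecutive edges of an axis is trivial, so the centralizer of an element
that is not conjugate into a factor acts faithfully by translations on its axis. -/
theorem exists_centralizer_hom_injective [Nonempty ι] (hφ : ∀ i, Function.Injective (φ i))
    {e : ι → ℕ} (he : Pairwise (Function.onFun Nat.Coprime e))
    (hmal : ∀ i, ∀ a ∉ (φ i).range, ∀ c, a⁻¹ * φ i c * a ∈ (φ i).range → c ^ e i = 1)
    {x : PushoutI φ} (hx : ∀ y i, y * x * y⁻¹ ∉ (of (φ := φ) i).range) :
    ∃ T : Subgroup.centralizer {x} →* Multiplicative ℤ, Function.Injective T := by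
  obtain ⟨d⟩ := transversal_nonempty φ hφ
  obtain ⟨y, L, h, t, hA⟩ := exists_isAxis d hx
  obtain ⟨T, hT⟩ := hA.exists_hom d
  let F : Subgroup.centralizer {x} →* Subgroup.centralizer {y * x * y⁻¹} :=
    ((MulAut.conj y).toMonoidHom.comp (Subgroup.subtype _)).codRestrict _ fun z => by
      rw [Subgroup.mem_centralizer_singleton_iff]
      exact (Commute.conj_iff y).2 (Subgroup.mem_centralizer_singleton_iff.1 z.2)
  refine ⟨T.comp F, (injective_iff_map_eq_one _).2 fun z hz => ?_⟩
  have h1 := hA.pow_eq_one hφ hmal (hT (F z) hz)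
  have h2 : (F z : PushoutI φ) = 1 := by
    rw [← orderOf_eq_one_iff]
    exact Nat.eq_one_of_dvd_coprimes (he (hA.alternating 0))
      (orderOf_dvd_of_pow_eq_one (h1 0)) (orderOf_dvd_of_pow_eq_one (h1 (0 + 1)))
  have h3 : y * z * y⁻¹ = 1 := h2
  exact Subtype.ext (conj_eq_one_iff.1 h3)

end Axis

end Monoid.PushoutI

section Carter

/-! ### Carter subgroups of the factors -/

/-- Let `C` be embedded as a self-normalizing subgroup of order `p * q` of a group whose centre has
a subgroup `Z` of order `q`. Then `Z` lies in `C`, and as `p` is prime nothing more than `Z` can lie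
in a proper conjugate of `C`. -/
theorem pow_eq_one_of_conj_mem_range {S C : Type*} [Group S] [Group C] {p q : ℕ} (hp : p.Prime)
    (hq : q ≠ 0) {f : C →* S} (hf : Function.Injective f)
    (hN : Subgroup.normalizer (f.range : Set S) = f.range) (hC : Nat.card C = p * q)
    {Z : Subgroup S} (hZ : Z ≤ Subgroup.center S) (hZq : Nat.card Z = q)
    {a : S} (ha : a ∉ f.range) {c : C} (hc : a⁻¹ * f c * a ∈ f.range) : c ^ q = 1 := by
  have hCfin : Finite C := Nat.finite_of_card_ne_zero (by rw [hC]; exact mul_ne_zero hp.ne_zero hq)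
  have hZf : Z ≤ f.range := by
    rw [← hN]
    exact hZ.trans (Subgroup.center_le_normalizer _)
  -- The elements of `C` that stay in `C` when conjugated by `a⁻¹`.
  let D : Subgroup C := f.range.comap ((MulAut.conj a⁻¹).toMonoidHom.comp f)
  have hD : ∀ b, b ∈ D ↔ a⁻¹ * f b * a ∈ f.range := fun b => by
    simp [D, Subgroup.mem_comap]
  have hZD : Z.comap f ≤ D := fun b hb => by
    rw [hD, mul_assoc, (Subgroup.mem_center_iff.1 (hZ hb) a).symm, inv_mul_cancel_left]
    exact ⟨b, rfl⟩
  have hZc : Nat.card (Z.comap f) = q := by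
    rw [← hZq, ← Subgroup.map_comap_eq_self hZf, Subgroup.card_map_of_injective hf,
      Subgroup.map_comap_eq_self hZf]
  have hqD : q ∣ Nat.card D := hZc ▸ Subgroup.card_dvd_of_le hZD
  obtain ⟨k, hk⟩ := hqD
  have hkp : k ∣ p := by
    have := Subgroup.card_subgroup_dvd_card D
    rw [hk, hC, mul_comm p] at this
    exact Nat.dvd_of_mul_dvd_mul_left (Nat.pos_of_ne_zero hq) this
  rcases (Nat.dvd_prime hp).1 hkp with rfl | rfl
  · rw [mul_one] at hk
    have : (⟨c, (hD c).2 hc⟩ : D) ^ q = 1 := by rw [← hk]; exact pow_card_eq_one'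
    exact congrArg Subtype.val this
  · have hT : D = ⊤ := Subgroup.eq_top_of_card_eq D (by rw [hk, hC, mul_comm])
    refine absurd ?_ ha
    rw [← hN, ← inv_mem_iff]
    have : Finite f.range := Finite.of_surjective _ f.rangeRestrict_surjective
    have : Finite (f.range : Set S) := this
    refine Subgroup.mem_normalizer_fintype ?_
    rintro _ ⟨b, rfl⟩
    rw [inv_inv]
    exact (hD b).1 (hT ▸ Subgroup.mem_top b)

variable {p q : ℕ} {Q H : Type*} [Group Q] [Group H] {φ : H →* MulAut Q}

theorem IsFactorAction.map_inl_center_le (hφ : IsFactorAction p q φ) :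
    (Subgroup.center Q).map (SemidirectProduct.inl : Q →* Q ⋊[φ] H) ≤ Subgroup.center _ := by
  rintro _ ⟨z, hz, rfl⟩
  rw [Subgroup.mem_center_iff]
  intro g
  ext
  · simp [hφ.trivial_on_center g.right z hz, Subgroup.mem_center_iff.1 hz]
  · simp

/-- In the factor `Q ⋊[φ] H`, the centre of `Q` is central of order `q`. Hence a Carter subgroup of
order `p * q` meets its proper conjugates in subgroups of exponent dividing `q`. -/
theorem IsFactorAction.pow_eq_one_of_conj_mem_range (hφ : IsFactorAction p q φ) (hp : p.Prime)
    (hq : q.Prime) {C : Type*} [Group C] (hC : Nat.card C = p * q) {f : C →* Q ⋊[φ] H}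
    (hf : Function.Injective f) (hK : IsCarterSubgroup f.range) {a : Q ⋊[φ] H} (ha : a ∉ f.range)
    {c : C} (hc : a⁻¹ * f c * a ∈ f.range) : c ^ q = 1 := by
  refine _root_.pow_eq_one_of_conj_mem_range hp hq.ne_zero hf hK.normalizer_eq hC
    hφ.map_inl_center_le ?_ ha hc
  rw [Subgroup.card_map_of_injective SemidirectProduct.inl_injective]
  exact hφ.extraspecial.card_center

end Carter

/-! ### Centralizers of hyperbolic elements -/

theorem mainTheorem4 (p q : ℕ) (hp : p.Prime) (hq : q.Prime) (hp_odd : Odd p) (hq_odd : Odd q)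
    (hpq : p ≠ q) {Q P H K : Type u} [Group Q] [Group P] [Group H] [Group K]
    (φ : H →* MulAut Q) (ψ : K →* MulAut P)
    (hA : IsFactorAction p q φ) (hB : IsFactorAction q p ψ)
    {C : Type*} [Group C] (hC_cyclic : IsCyclic C) (hC_card : Nat.card C = p * q)
    (f : C →* Q ⋊[φ] H) (g : C →* P ⋊[ψ] K)
    (hf : Function.Injective f) (hg : Function.Injective g)
    (hf_carter : IsCarterSubgroup f.range) (hg_carter : IsCarterSubgroup g.range)
    (x : Amalgam f g)
    (hx : ∀ y : Amalgam f g,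
      y * x * y⁻¹ ∉ ((Amalgam.inl f g).range : Set (Amalgam f g)) ∪ (Amalgam.inr f g).range) :
    (∀ c ∈ Subgroup.centralizer {x}, IsOfFinOrder c → c = 1) ∧
    Subgroup.center (Subgroup.centralizer {x}) ≠ ⊥ ∧
    Nonempty (FreeGroupBasis Unit (Subgroup.centralizer {x})) ∧
    IsCyclic (Subgroup.centralizer {x}) ∧ Infinite (Subgroup.centralizer {x}) := by
  have hx' : ∀ (y : Amalgam f g) (i : Bool),
      y * x * y⁻¹ ∉ (Monoid.PushoutI.of (φ := amalgamMap f g) i).range := fun y i hi => by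
    cases i
    · exact hx y (Or.inl hi)
    · exact hx y (Or.inr hi)
  obtain ⟨T, hT⟩ := Monoid.PushoutI.exists_centralizer_hom_injective (φ := amalgamMap f g)
    (e := fun i => cond i p q) (by rintro (_ | _); exacts [hf, hg])
    (by
      rintro (_ | _) (_ | _) hij
      exacts [absurd rfl hij, (Nat.coprime_primes hq hp).2 hpq.symm,
        (Nat.coprime_primes hp hq).2 hpq, absurd rfl hij])
    (by
      rintro (_ | _) a ha c hc
      · exact hA.pow_eq_one_of_conj_mem_range hp hq hC_card hf hf_carter ha hc
      · exact hB.pow_eq_one_of_conj_mem_range hq hp (by rw [hC_card, mul_comm]) hg hg_carter ha hc)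
    hx'
  have htf : ∀ c : Subgroup.centralizer {x}, IsOfFinOrder c → c = 1 := fun c hc =>
    hT (((isOfFinOrder_iff_eq_one _).1 (T.isOfFinOrder hc)).trans (map_one T).symm)
  have hcyc : IsCyclic (Subgroup.centralizer {x}) := isCyclic_of_injective T hT
  have hx1 : x ≠ 1 := by
    rintro rfl
    exact hx' 1 false ⟨1, by simp⟩
  have : Nontrivial (Subgroup.centralizer {x}) :=
    ⟨⟨⟨x, Subgroup.mem_centralizer_singleton_iff.2 rfl⟩, 1, fun h => hx1 (congrArg Subtype.val h)⟩⟩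
  have hinf : Infinite (Subgroup.centralizer {x}) := by
    by_contra hfin
    rw [not_infinite_iff_finite] at hfin
    obtain ⟨c, hc⟩ := exists_ne (1 : Subgroup.centralizer {x})
    exact hc (htf c (isOfFinOrder_of_finite c))
  refine ⟨fun c hc hfo => congrArg Subtype.val (htf ⟨c, hc⟩ (Submonoid.isOfFinOrder_coe.1 hfo)),
    ?_, ?_, hcyc, hinf⟩
  · have := hcyc.isMulCommutative
    rw [Subgroup.center_eq_top]
    exact top_ne_bot
  · let E : FreeGroup Unit ≃* Subgroup.centralizer {x} :=
      FreeGroup.mulEquivIntOfUnique.trans (mulEquivOfCyclicCardEq (by simp))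
    exact ⟨FreeGroupBasis.ofRepr E.symm⟩
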